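/- Let \(X\) be a real or complex Banach space with dual \(X^*\), and let \((x_n)\) be a bounded sequence in \(X\). (a) (Rosenthal's \(\ell_1\)-theorem) \((x_n)\) has a subsequence \((x_{m_n})\) which is either weak Cauchy (that is, \((f(x_{m_n}))_n\) is a Cauchy sequence of scalars for every \(f \in X^*\)) or equivalent to the unit vector basis \((e_n)\) of \(\ell_1\) (that is, there are constants \(c, C > 0\) such that \[ c\,\Bigl\|\sum_n \lambda_n e_n\Bigr\|_{\ell_1} \le \Bigl\|\sum_n \lambda_n x_{m_n}\Bigr\| \le C\,\Bigl\|\sum_n \lambda_n e_n\Bigr\|_{\ell_1} \] for every finitely supported sequence of scalars \((\lambda_n)\)). (b) (Quantitative version) Put \(\kappa = 1/2\) if the scalars are real and \(\kappa = \sqrt2/8\) if they are complex. For every \(\epsilon > 0\), either \((x_n)\) has an \(\epsilon\)-weak Cauchy subsequence, i.e. a subsequence \((y_n)\) such that for every \(f \in X^*\) with \(\|f\| \le 1\) there is \(n_0\) with \(|f(y_n) - f(y_m)| < \epsilon\) for all \(n, m \ge n_0\); or, for every \(\delta > 0\), there is a subsequence \((x_{m_n})\) such that \[ \Bigl\|\sum_n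 \lambda_n x_{m_n}\Bigr\| \ge (\kappa\epsilon - \delta) \sum_n \bigl(|\mathrm{Re}\,\lambda_n| + |\mathrm{Im}\,\lambda_n|\bigr) \] for every finitely supported sequence of scalars \((\lambda_n)\). -/

import Mathlib

/-- A sequence `x` in a normed space over `𝕜` is weak Cauchy if the scalar sequence `f (x n)` is
Cauchy for every continuous linear functional `f`. -/
def IsWeakCauchySeq (𝕜 : Type*) [RCLike 𝕜] {X : Type*} [NormedAddCommGroup X] [NormedSpace 𝕜 X]
    (x : ℕ → X) : Prop :=
  ∀ f : StrongDual 𝕜 X, CauchySeq fun n => f (x n)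

/-- A sequence `x` is `ε`-weak Cauchy if for every `f` in the closed unit ball of the dual there is
`n₀` such that `|f (x n) - f (x m)| < ε` for all `n, m ≥ n₀`. -/
def IsEpsWeakCauchySeq (𝕜 : Type*) [RCLike 𝕜] {X : Type*} [NormedAddCommGroup X]
    [NormedSpace 𝕜 X] (ε : ℝ) (x : ℕ → X) : Prop :=
  ∀ f : StrongDual 𝕜 X, ‖f‖ ≤ 1 → ∃ n₀ : ℕ, ∀ n ≥ n₀, ∀ m ≥ n₀, ‖f (x n) - f (x m)‖ < ε

/-- Two sequences `x`, `y` in normed spaces over `𝕜` are equivalent if, for some constants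
`0 < c` and `0 < C`, `c ‖∑ aₙ yₙ‖ ≤ ‖∑ aₙ xₙ‖ ≤ C ‖∑ aₙ yₙ‖` for all finitely supported scalar
sequences `a`. -/
def SeqEquivalent (𝕜 : Type*) [RCLike 𝕜] {X Y : Type*} [NormedAddCommGroup X] [NormedSpace 𝕜 X]
    [NormedAddCommGroup Y] [NormedSpace 𝕜 Y] (x : ℕ → X) (y : ℕ → Y) : Prop :=
  ∃ c C : ℝ, 0 < c ∧ 0 < C ∧ ∀ a : ℕ →₀ 𝕜,
    c * ‖a.sum fun n r => r • y n‖ ≤ ‖a.sum fun n r => r • x n‖ ∧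
    ‖a.sum fun n r => r • x n‖ ≤ C * ‖a.sum fun n r => r • y n‖

/-- The unit vector basis of `ℓ₁` over `𝕜`. -/
noncomputable def ellOneBasis (𝕜 : Type*) [RCLike 𝕜] (n : ℕ) : lp (fun _ : ℕ => 𝕜) 1 :=
  lp.single 1 n (1 : 𝕜)

open Classical in
/-- The constant of the quantitative theorem: `1/2` for real scalars (where the imaginary unit of
`RCLike` is `0`) and `√2/8` for complex scalars. -/
noncomputable def ellOneConst (𝕜 : Type*) [RCLike 𝕜] : ℝ :=
  if (RCLike.I : 𝕜) = 0 then 1 / 2 else Real.sqrt 2 / 8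

theorem ellOneConst_real : ellOneConst ℝ = 1 / 2 := by
  simp [ellOneConst]

theorem ellOneConst_complex : ellOneConst ℂ = Real.sqrt 2 / 8 := by
  simp [ellOneConst]

/-! If no subsequence is ε-weak Cauchy, then along every subsequence the values of some functional
in the dual unit ball oscillate by at least ε. Up to a finite net, these oscillations can be taken,
along every further subsequence, between two fixed scalars `c`, `d` with ‖c - d‖ almost ε
(`exists_infinite_forall_subset_of_finite`).

The combinatorial core, `exists_split_hereditarilyOscillatesOn`, splits finitely many sets of
functionals at one index and keeps the oscillation hereditary. Iterated, it yields a subsequence on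
which all finite patterns of `c` and `d` occur approximately. Two functionals with opposite
patterns, dictated by the signs of the real or imaginary parts of the coefficients, have a
difference that gives the ℓ₁ lower bound.

If instead every subsequence has ε-weak Cauchy subsequences for all ε, a diagonal sequence is weak
Cauchy. -/

/-! ### Diagonal sequences and infinite index sets -/

/-- Recursive choice of a diagonal sequence: if from every state `s` one can pick a point `j` of its
carrier `c s` and pass to a state with carrier inside `c s` and beyond `j`, then iterating this gives
a strictly increasing sequence whose tails lie in the carriers. -/
theorem exists_strictMono_diagonal {σ : Type*} (c : σ → Set ℕ) (R : ℕ → σ → ℕ → σ → Prop)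
    (h : ∀ k s, ∃ j ∈ c s, ∃ s', R k s j s' ∧ c s' ⊆ c s ∩ Set.Ioi j) (s₀ : σ) :
    ∃ (n : ℕ → ℕ) (s : ℕ → σ), StrictMono n ∧ s 0 = s₀ ∧
      (∀ k, R k (s k) (n k) (s (k + 1))) ∧ ∀ k l, k ≤ l → n l ∈ c (s k) := by
  choose j hj s' hR hc using h
  let s : ℕ → σ := fun k => Nat.rec s₀ (fun k s => s' k s) k
  have hs : ∀ k, s (k + 1) = s' k (s k) := fun _ => rfl
  have hanti : Antitone fun k => c (s k) :=
    antitone_nat_of_succ_le fun k => (hc k (s k)).trans Set.inter_subset_left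
  have hmem : ∀ k l, k ≤ l → j l (s l) ∈ c (s k) := fun k l hkl => hanti hkl (hj l (s l))
  exact ⟨fun k => j k (s k), s,
    strictMono_nat_of_lt_succ fun k => (hc k (s k) (hmem (k + 1) (k + 1) le_rfl)).2,
    rfl, fun k => hR k (s k), hmem⟩

theorem Set.Infinite.inter_Ioi {M : Set ℕ} (hM : M.Infinite) (j : ℕ) :
    (M ∩ Set.Ioi j).Infinite := by
  refine (hM.sdiff (Set.finite_Iic j)).mono fun n hn => ⟨hn.1, ?_⟩
  simpa using hn.2

/-- If along each infinite set one of finitely many upward closed properties holds, then one of them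
holds along all infinite subsets of some infinite set. -/
theorem exists_infinite_forall_subset_of_finite {ι : Type*} (t : Finset ι)
    (Q : ι → Set ℕ → Prop) (hQ : ∀ i, Monotone (Q i)) (M : Set ℕ) (hM : M.Infinite)
    (h : ∀ N ⊆ M, N.Infinite → ∃ i ∈ t, Q i N) :
    ∃ i ∈ t, ∃ N ⊆ M, N.Infinite ∧ ∀ N' ⊆ N, N'.Infinite → Q i N' := by
  classical
  induction t using Finset.induction_on generalizing M with
  | empty => simpa using h M subset_rfl hM
  | insert i t _ ih =>
    by_cases hi : ∀ N ⊆ M, N.Infinite → Q i N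
    · exact ⟨i, by simp, M, subset_rfl, hM, hi⟩
    push Not at hi
    obtain ⟨N, hNM, hN, hQN⟩ := hi
    -- By monotonicity `Q i` fails on every subset of `N`, so `i` can be discarded below `N`.
    obtain ⟨j, hj, N', hN', h1, h2⟩ := ih N hN fun N' hN' hinf => by
      obtain ⟨j, hj, hjN⟩ := h N' (hN'.trans hNM) hinf
      rcases Finset.mem_insert.1 hj with rfl | hj
      · exact absurd (hQ j hN' hjN) hQN
      · exact ⟨j, hj, hjN⟩
    exact ⟨j, by simp [hj], N', hN'.trans hNM, h1, h2⟩

/-! ### Oscillation and independence of pairs of sets -/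

/-- Some point of `S` lies in infinitely many of the sets `A n`, `n ∈ M`, and in infinitely many of
the sets `B n`, `n ∈ M`. -/
def OscillatesOn {Ω : Type*} (A B : ℕ → Set Ω) (S : Set Ω) (M : Set ℕ) : Prop :=
  ∃ f ∈ S, {n ∈ M | f ∈ A n}.Infinite ∧ {n ∈ M | f ∈ B n}.Infinite

/-- `OscillatesOn A B S` holds along every infinite subset of `M`. -/
def HereditarilyOscillatesOn {Ω : Type*} (A B : ℕ → Set Ω) (S : Set Ω) (M : Set ℕ) : Prop :=
  ∀ N ⊆ M, N.Infinite → OscillatesOn A B S N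

section Oscillation

variable {Ω : Type*} {A B : ℕ → Set Ω} {S : Set Ω} {M N : Set ℕ}

theorem OscillatesOn.mono (h : OscillatesOn A B S M) (hMN : M ⊆ N) : OscillatesOn A B S N := by
  obtain ⟨f, hf, h1, h2⟩ := h
  exact ⟨f, hf, h1.mono fun n hn => ⟨hMN hn.1, hn.2⟩, h2.mono fun n hn => ⟨hMN hn.1, hn.2⟩⟩

/-- Finitely many sets on which the sequence of pairs `(A n, B n)` hereditarily oscillates can be
split simultaneously by some pair `(A j, B j)`. -/
theorem exists_split_hereditarilyOscillatesOn (T : Finset (Set Ω)) (hM : M.Infinite)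
    (hT : ∀ S ∈ T, HereditarilyOscillatesOn A B S M) :
    ∃ j ∈ M, ∃ N ⊆ M ∩ Set.Ioi j, N.Infinite ∧ ∀ S ∈ T,
      HereditarilyOscillatesOn A B (A j ∩ S) N ∧ HereditarilyOscillatesOn A B (B j ∩ S) N := by
  by_contra hcon
  push Not at hcon
  let c : {N : Set ℕ // N ⊆ M ∧ N.Infinite} → Set ℕ := Subtype.val
  obtain ⟨n, s, hn, -, hR, hmem⟩ := exists_strictMono_diagonal c
    (fun _ _ j N => ∃ S ∈ T,
      ¬ OscillatesOn A B (A j ∩ S) N ∨ ¬ OscillatesOn A B (B j ∩ S) N) (by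
      rintro - ⟨N, hNM, hN⟩
      obtain ⟨j, hj⟩ := hN.nonempty
      obtain ⟨S, hS, hbad⟩ := hcon j (hNM hj) (N ∩ Set.Ioi j)
        (Set.inter_subset_inter_left _ hNM) (hN.inter_Ioi j)
      have key : ∃ N' ⊆ N ∩ Set.Ioi j, N'.Infinite ∧
          (¬ OscillatesOn A B (A j ∩ S) N' ∨ ¬ OscillatesOn A B (B j ∩ S) N') := by
        by_cases hA : HereditarilyOscillatesOn A B (A j ∩ S) (N ∩ Set.Ioi j)
        · have hB := hbad hA
          unfold HereditarilyOscillatesOn at hB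
          push Not at hB
          obtain ⟨N', h1, h2, h3⟩ := hB
          exact ⟨N', h1, h2, Or.inr h3⟩
        · unfold HereditarilyOscillatesOn at hA
          push Not at hA
          obtain ⟨N', h1, h2, h3⟩ := hA
          exact ⟨N', h1, h2, Or.inl h3⟩
      obtain ⟨N', h1, h2, h3⟩ := key
      exact ⟨j, hj, ⟨N', fun m hm => hNM (h1 hm).1, h2⟩, ⟨S, hS, h3⟩, h1⟩) ⟨M, subset_rfl, hM⟩
  choose S hST hbad using hR
  -- Pigeonhole: for infinitely many `k` the set `S k` is the same, and so is the truth value of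
  -- oscillation on the `A` side. One `f` oscillating along these indices refutes both alternatives
  -- of `hbad`.
  let g : ℕ → T × Prop := fun k => (⟨S k, hST k⟩, OscillatesOn A B (A (n k) ∩ S k) (s (k + 1)).1)
  obtain ⟨y, hy⟩ := Finite.exists_infinite_fiber g
  have hK : (g ⁻¹' {y}).Infinite := Set.infinite_coe_iff.1 hy
  have hinf : (n '' (g ⁻¹' {y})).Infinite := hK.image hn.injective.injOn
  obtain ⟨f, hfS, hfA, hfB⟩ := hT y.1 y.1.2 (n '' (g ⁻¹' {y}))
    (by rintro _ ⟨k, -, rfl⟩; exact (s 0).2.1 (hmem 0 k (Nat.zero_le k))) hinf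
  have tail : ∀ k, ∀ C : ℕ → Set Ω, {m ∈ n '' (g ⁻¹' {y}) | f ∈ C m}.Infinite →
      {m ∈ (s (k + 1)).1 | f ∈ C m}.Infinite := by
    intro k C hC
    refine (hC.inter_Ioi (n k)).mono ?_
    rintro m ⟨⟨⟨l, -, rfl⟩, h2⟩, h3⟩
    exact ⟨hmem (k + 1) l (hn.lt_iff_lt.1 h3), h2⟩
  obtain ⟨_, ⟨k, hk, rfl⟩, hfk⟩ := hfA.nonempty
  obtain ⟨_, ⟨l, hl, rfl⟩, hfl⟩ := hfB.nonempty
  have hSk : S k = y.1 := congrArg (fun z => (z.1 : Set Ω)) hk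
  have hSl : S l = y.1 := congrArg (fun z => (z.1 : Set Ω)) hl
  have h2k : OscillatesOn A B (A (n k) ∩ S k) (s (k + 1)).1 = y.2 := congrArg Prod.snd hk
  have h2l : OscillatesOn A B (A (n l) ∩ S l) (s (l + 1)).1 = y.2 := congrArg Prod.snd hl
  have hosc : OscillatesOn A B (A (n k) ∩ S k) (s (k + 1)).1 :=
    ⟨f, ⟨hfk, hSk ▸ hfS⟩, tail k A hfA, tail k B hfB⟩
  rcases hbad l with hb | hb
  -- Only the common truth value passes from `k` to `l`; `f` need not lie in `A (n l)`.
  · exact hb (h2l ▸ h2k ▸ hosc)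
  · exact hb ⟨f, ⟨hfl, hSl ▸ hfS⟩, tail l A hfA, tail l B hfB⟩

/-- A hereditarily oscillating sequence of pairs has a subsequence all of whose finite sign patterns
are realised. -/
theorem HereditarilyOscillatesOn.exists_independent_subseq (hM : M.Infinite)
    (h : HereditarilyOscillatesOn A B S M) :
    ∃ φ : ℕ → ℕ, StrictMono φ ∧ ∀ (G : Set ℕ) (K : ℕ), ∃ f ∈ S, ∀ k < K,
      (k ∈ G → f ∈ A (φ k)) ∧ (k ∉ G → f ∈ B (φ k)) := by
  classical
  -- A state is a finite family of cells with an infinite index set on which all of them oscillate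
  -- hereditarily. Each step replaces every cell by its traces on `A j` and `B j`.
  let c : {p : Finset (Set Ω) × Set ℕ //
      p.2.Infinite ∧ ∀ S ∈ p.1, HereditarilyOscillatesOn A B S p.2} → Set ℕ := fun p => p.1.2
  obtain ⟨n, s, hn, hs0, hR, -⟩ := exists_strictMono_diagonal c
    (fun _ p j q => ∀ S ∈ p.1.1, A j ∩ S ∈ q.1.1 ∧ B j ∩ S ∈ q.1.1) (by
      rintro - ⟨⟨T, N⟩, hN, hT⟩
      obtain ⟨j, hj, N', h1, h2, h3⟩ := exists_split_hereditarilyOscillatesOn T hN hT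
      refine ⟨j, hj, ⟨⟨T.image (A j ∩ ·) ∪ T.image (B j ∩ ·), N'⟩, h2, fun S hS => ?_⟩, fun S hS => ?_, h1⟩
      · rcases Finset.mem_union.1 hS with hS | hS
        · obtain ⟨U, hU, rfl⟩ := Finset.mem_image.1 hS
          exact (h3 U hU).1
        · obtain ⟨U, hU, rfl⟩ := Finset.mem_image.1 hS
          exact (h3 U hU).2
      · exact ⟨Finset.mem_union_left _ (Finset.mem_image_of_mem _ hS),
          Finset.mem_union_right _ (Finset.mem_image_of_mem _ hS)⟩)
    ⟨⟨{S}, M⟩, hM, by simpa using h⟩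
  refine ⟨n, hn, fun G K => ?_⟩
  have key : ∃ U ∈ (s K).1.1, U ⊆ S ∧ ∀ f ∈ U, ∀ k < K,
      (k ∈ G → f ∈ A (n k)) ∧ (k ∉ G → f ∈ B (n k)) := by
    induction K with
    | zero => exact ⟨S, by simp [hs0], subset_rfl, by simp⟩
    | succ K ih =>
      obtain ⟨U, hU, hUS, hf⟩ := ih
      by_cases hG : K ∈ G
      · refine ⟨_, (hR K U hU).1, fun f hf => hUS hf.2, fun f hfU k hk => ?_⟩
        rcases Nat.lt_succ_iff_lt_or_eq.1 hk with hk | rfl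
        · exact hf f hfU.2 k hk
        · exact ⟨fun _ => hfU.1, fun h => absurd hG h⟩
      · refine ⟨_, (hR K U hU).2, fun f hf => hUS hf.2, fun f hfU k hk => ?_⟩
        rcases Nat.lt_succ_iff_lt_or_eq.1 hk with hk | rfl
        · exact hf f hfU.2 k hk
        · exact ⟨fun h => absurd h hG, fun _ => hfU.1⟩
  obtain ⟨U, hU, hUS, hf⟩ := key
  obtain ⟨f, hfU, -⟩ := (s K).2.2 U hU _ subset_rfl (s K).2.1
  exact ⟨f, hUS hfU, hf f hfU⟩

end Oscillation

/-! ### Functionals and lower ℓ₁-estimates -/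

section Banach

variable {𝕜 : Type*} [RCLike 𝕜] {X : Type*} [NormedAddCommGroup X] [NormedSpace 𝕜 X]

/-- A scalar sequence with pairs of terms at distance at least `ε` arbitrarily far out is infinitely
often close to each of two points of a given finite net. -/
theorem exists_infinite_infinite_of_not_cauchy {u : ℕ → 𝕜} {t : Finset 𝕜} {ε η : ℝ} {M : Set ℕ}
    (hu : ∀ n, ∃ c ∈ t, ‖u n - c‖ ≤ η)
    (h : ∀ n₀, ∃ n ≥ n₀, ∃ m ≥ n₀, n ∈ M ∧ m ∈ M ∧ ε ≤ ‖u n - u m‖) :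
    ∃ p ∈ t ×ˢ t, ε - 2 * η ≤ ‖p.1 - p.2‖ ∧
      {n ∈ M | ‖u n - p.1‖ ≤ η}.Infinite ∧ {n ∈ M | ‖u n - p.2‖ ≤ η}.Infinite := by
  choose a ha b hb haM hbM hab using h
  choose c hct hc using hu
  obtain ⟨y, hy⟩ := Finite.exists_infinite_fiber
    (fun k => ((⟨c (a k), hct _⟩, ⟨c (b k), hct _⟩) : t × t))
  have hK := Set.infinite_coe_iff.1 hy
  have hya : ∀ k ∈ (fun k => ((⟨c (a k), hct _⟩, ⟨c (b k), hct _⟩) : t × t)) ⁻¹' {y},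
      c (a k) = y.1 ∧ c (b k) = y.2 := fun k hk =>
    ⟨congrArg (fun z => (z.1 : 𝕜)) hk, congrArg (fun z => (z.2 : 𝕜)) hk⟩
  refine ⟨(y.1, y.2), Finset.mem_product.2 ⟨y.1.2, y.2.2⟩, ?_, ?_, ?_⟩
  · obtain ⟨k, hk⟩ := hK.nonempty
    have h1 := hc (a k)
    have h2 := hc (b k)
    rw [(hya k hk).1] at h1
    rw [(hya k hk).2] at h2
    have h3 : ‖u (a k) - u (b k)‖ ≤ ‖u (a k) - y.1‖ + ‖(y.1 : 𝕜) - y.2‖ + ‖u (b k) - y.2‖ := by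
      calc ‖u (a k) - u (b k)‖ = ‖(u (a k) - y.1) + (y.1 - y.2) - (u (b k) - y.2)‖ := by
            congr 1; ring
        _ ≤ _ := (norm_sub_le _ _).trans (by gcongr; exact norm_add_le _ _)
    have := hab k
    simp only
    linarith
  · refine Set.infinite_of_forall_exists_gt fun m => ?_
    obtain ⟨k, hk, hmk⟩ := hK.exists_gt m
    exact ⟨a k, ⟨haM k, (hya k hk).1 ▸ hc _⟩, hmk.trans_le (ha k)⟩
  · refine Set.infinite_of_forall_exists_gt fun m => ?_
    obtain ⟨k, hk, hmk⟩ := hK.exists_gt m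
    exact ⟨b k, ⟨hbM k, (hya k hk).2 ▸ hc _⟩, hmk.trans_le (hb k)⟩

/-- A bounded sequence without `ε`-weak Cauchy subsequences has a subsequence on which functionals in
the dual unit ball realise, up to `η`, all finite patterns of two scalars at distance almost `ε`. -/
theorem exists_independent_subseq_of_not_isEpsWeakCauchySeq {x : ℕ → X} {B ε η : ℝ}
    (hB : ∀ n, ‖x n‖ ≤ B) (hη : 0 < η)
    (h : ∀ φ : ℕ → ℕ, StrictMono φ → ¬ IsEpsWeakCauchySeq 𝕜 ε (x ∘ φ)) :
    ∃ φ : ℕ → ℕ, StrictMono φ ∧ ∃ c d : 𝕜, ε - 2 * η ≤ ‖c - d‖ ∧ ∀ (G : Set ℕ) (K : ℕ),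
      ∃ f : StrongDual 𝕜 X, ‖f‖ ≤ 1 ∧ ∀ k < K,
        (k ∈ G → ‖f (x (φ k)) - c‖ ≤ η) ∧ (k ∉ G → ‖f (x (φ k)) - d‖ ≤ η) := by
  classical
  obtain ⟨t, -, htf, ht⟩ := (isCompact_closedBall (0 : 𝕜) B).finite_cover_balls hη
  lift t to Finset 𝕜 using htf
  let A : 𝕜 → ℕ → Set (StrongDual 𝕜 X) := fun c n => {f | ‖f (x n) - c‖ ≤ η}
  -- The distance bound does not involve `f`; placing it in `S p` carries it through the choice of
  -- `p`.
  let S : 𝕜 × 𝕜 → Set (StrongDual 𝕜 X) := fun p => {f | ‖f‖ ≤ 1 ∧ ε - 2 * η ≤ ‖p.1 - p.2‖}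
  obtain ⟨p, -, N, -, hN, hosc⟩ := exists_infinite_forall_subset_of_finite (t ×ˢ t)
    (fun p => OscillatesOn (A p.1) (A p.2) (S p)) (fun _ _ _ hMN h => h.mono hMN)
    Set.univ Set.infinite_univ (fun M _ hM => by
      have := hM.to_subtype
      have hφ := h _ (Nat.orderEmbeddingOfSet M).strictMono
      unfold IsEpsWeakCauchySeq at hφ
      push Not at hφ
      obtain ⟨f, hf, hfε⟩ := hφ
      obtain ⟨p, hp, hpε, h1, h2⟩ := exists_infinite_infinite_of_not_cauchy (u := fun n => f (x n))
        (t := t) (M := M) (ε := ε) (η := η) (fun n => by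
          have hn : f (x n) ∈ Metric.closedBall (0 : 𝕜) B := by
            rw [mem_closedBall_zero_iff]
            exact ((f.le_of_opNorm_le hf _).trans_eq (one_mul _)).trans (hB n)
          obtain ⟨c, hc, hnc⟩ := Set.mem_iUnion₂.1 (ht hn)
          exact ⟨c, hc, (mem_ball_iff_norm.1 hnc).le⟩) (fun n₀ => by
          obtain ⟨n, hn, m, hm, hnm⟩ := hfε n₀
          have hle : ∀ i, i ≤ Nat.orderEmbeddingOfSet M i := fun _ => (Nat.orderEmbeddingOfSet M).strictMono.le_apply
          exact ⟨_, hn.trans (hle n), _, hm.trans (hle m), Subtype.coe_prop (Nat.Subtype.ofNat M n),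
            Subtype.coe_prop (Nat.Subtype.ofNat M m), hnm⟩)
      exact ⟨p, hp, f, ⟨hf, hpε⟩, h1, h2⟩)
  obtain ⟨φ, hφ, hind⟩ := HereditarilyOscillatesOn.exists_independent_subseq hN hosc
  obtain ⟨f, hf, -⟩ := hind ∅ 0
  refine ⟨φ, hφ, p.1, p.2, hf.2, fun G K => ?_⟩
  obtain ⟨f, hf, hfk⟩ := hind G K
  exact ⟨f, hf.1, hfk⟩

/-- Lower estimate for a linear combination in terms of the coordinates of its coefficients, from
functionals that realise all finite patterns of two scalars. -/
theorem sum_abs_le_of_independent {y : ℕ → X} {ε η : ℝ} {c d : 𝕜} (hcd : ε - 2 * η ≤ ‖c - d‖)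
    (hind : ∀ (G : Set ℕ) (K : ℕ), ∃ f : StrongDual 𝕜 X, ‖f‖ ≤ 1 ∧ ∀ k < K,
      (k ∈ G → ‖f (y k) - c‖ ≤ η) ∧ (k ∉ G → ‖f (y k) - d‖ ≤ η))
    (ρ : 𝕜 →ₗ[ℝ] ℝ) (hρ : ∀ z, |ρ z| ≤ ‖z‖) (a : ℕ →₀ 𝕜) :
    (ε - 2 * η) * (a.sum fun _ r => |ρ r|) - 2 * η * (a.sum fun _ r => ‖r‖) ≤
      2 * ‖a.sum fun n r => r • y n‖ := by
  classical
  obtain ⟨K, hK⟩ : ∃ K, ∀ k ∈ a.support, k < K :=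
    ⟨a.support.sup id + 1, fun k hk => Nat.lt_succ_of_le (Finset.le_sup (f := id) hk)⟩
  obtain ⟨f, hf1, hf⟩ := hind {k | 0 ≤ ρ (a k)} K
  obtain ⟨g, hg1, hg⟩ := hind {k | 0 ≤ ρ (a k)}ᶜ K
  let σ : ℕ → ℝ := fun k => if 0 ≤ ρ (a k) then 1 else -1
  have herr : ∀ k ∈ a.support, ‖(f - g) (y k) - (σ k : 𝕜) * (c - d)‖ ≤ 2 * η := by
    intro k hk
    have h1 := hf k (hK k hk)
    have h2 := hg k (hK k hk)
    by_cases hs : 0 ≤ ρ (a k)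
    · have h1 := h1.1 hs
      have h2 := h2.2 (by simpa using hs)
      calc _ = ‖(f (y k) - c) - (g (y k) - d)‖ := by simp [σ, hs]; congr 1; ring
        _ ≤ _ := (norm_sub_le _ _).trans (by linarith)
    · have h1 := h1.2 hs
      have h2 := h2.1 (by simpa using hs)
      calc _ = ‖(f (y k) - d) - (g (y k) - c)‖ := by simp [σ, hs]; congr 1; ring
        _ ≤ _ := (norm_sub_le _ _).trans (by linarith)
  have hmain : ρ (∑ k ∈ a.support, a k * (σ k : 𝕜)) = a.sum fun _ r => |ρ r| := by
    rw [map_sum, Finsupp.sum]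
    refine Finset.sum_congr rfl fun k _ => ?_
    have : a k * (σ k : 𝕜) = σ k • a k := by rw [RCLike.real_smul_eq_coe_mul, mul_comm]
    rw [this, map_smul, smul_eq_mul]
    by_cases hs : 0 ≤ ρ (a k)
    · simp [σ, hs, abs_of_nonneg hs]
    · simp [σ, hs, abs_of_neg (not_le.1 hs)]
  have hsplit : (∑ k ∈ a.support, a k * (σ k : 𝕜)) * (c - d) = (f - g) (a.sum fun n r => r • y n) -
      ∑ k ∈ a.support, a k * ((f - g) (y k) - (σ k : 𝕜) * (c - d)) := by
    rw [Finsupp.sum, map_sum, ← Finset.sum_sub_distrib, Finset.sum_mul]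
    refine Finset.sum_congr rfl fun k _ => ?_
    rw [map_smul, smul_eq_mul]
    ring
  have hW : ‖∑ k ∈ a.support, a k * ((f - g) (y k) - (σ k : 𝕜) * (c - d))‖ ≤
      2 * η * (a.sum fun _ r => ‖r‖) := by
    rw [Finsupp.sum, Finset.mul_sum]
    refine norm_sum_le_of_le _ fun k hk => ?_
    rw [norm_mul, mul_comm]
    exact mul_le_mul_of_nonneg_right (herr k hk) (norm_nonneg _)
  have hfg : ‖(f - g) (a.sum fun n r => r • y n)‖ ≤ 2 * ‖a.sum fun n r => r • y n‖ := by
    refine (f - g).le_of_opNorm_le ((norm_sub_le _ _).trans (by linarith)) _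
  have hlow : (ε - 2 * η) * (a.sum fun _ r => |ρ r|) ≤
      ‖(∑ k ∈ a.support, a k * (σ k : 𝕜)) * (c - d)‖ := by
    have h0 : 0 ≤ a.sum fun _ r => |ρ r| := Finset.sum_nonneg fun _ _ => abs_nonneg _
    -- `ρ` is applied before multiplying by `c - d`, so the phase of `c - d` plays no role.
    have h1 : (a.sum fun _ r => |ρ r|) ≤ ‖∑ k ∈ a.support, a k * (σ k : 𝕜)‖ :=
      hmain ▸ (le_abs_self _).trans (hρ _)
    rw [norm_mul, mul_comm]
    exact (mul_le_mul_of_nonneg_left hcd h0).trans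
      (mul_le_mul_of_nonneg_right h1 (norm_nonneg _))
  have hsub := norm_sub_le ((f - g) (a.sum fun n r => r • y n))
    (∑ k ∈ a.support, a k * ((f - g) (y k) - (σ k : 𝕜) * (c - d)))
  rw [← hsplit] at hsub
  linarith

theorem ellOneConst_pos : 0 < ellOneConst 𝕜 := by
  unfold ellOneConst
  split_ifs <;> positivity

/-- The real parts or the imaginary parts of the coefficients contribute at least the fraction
`2 * ellOneConst 𝕜` of the total. -/
theorem ellOneConst_mul_le_max (a : ℕ →₀ 𝕜) :
    2 * ellOneConst 𝕜 * (a.sum fun _ r => |RCLike.re r| + |RCLike.im r|) ≤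
      max (a.sum fun _ r => |RCLike.re r|) (a.sum fun _ r => |RCLike.im r|) := by
  have hre : 0 ≤ a.sum fun _ r => |RCLike.re r| := Finset.sum_nonneg fun _ _ => abs_nonneg _
  have him : 0 ≤ a.sum fun _ r => |RCLike.im r| := Finset.sum_nonneg fun _ _ => abs_nonneg _
  have hadd : (a.sum fun _ r => |RCLike.re r| + |RCLike.im r|) =
      (a.sum fun _ r => |RCLike.re r|) + a.sum fun _ r => |RCLike.im r| := Finsupp.sum_add
  rw [hadd]
  unfold ellOneConst
  split_ifs with hI
  · have h0 : (a.sum fun _ r => |RCLike.im r|) = 0 :=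
      Finset.sum_eq_zero fun k _ => by simp [RCLike.im_eq_zero hI]
    rw [h0]
    simp [hre]
  -- The maximum is at least half the total, and 2κ = √2/4 ≤ 1/2.
  · have hsqrt : Real.sqrt 2 ≤ 2 := by
      rw [Real.sqrt_le_left (by norm_num)]; norm_num
    have h1 := le_max_left (a.sum fun _ r => |RCLike.re r|) (a.sum fun _ r => |RCLike.im r|)
    have h2 := le_max_right (a.sum fun _ r => |RCLike.re r|) (a.sum fun _ r => |RCLike.im r|)
    nlinarith [mul_le_mul_of_nonneg_right hsqrt (add_nonneg hre him)]

theorem sum_norm_le_sum_abs_re_add_abs_im (a : ℕ →₀ 𝕜) :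
    (a.sum fun _ r => ‖r‖) ≤ a.sum fun _ r => |RCLike.re r| + |RCLike.im r| :=
  Finset.sum_le_sum fun k _ => by
    have h := norm_add_le (RCLike.re (a k) : 𝕜) (RCLike.im (a k) * RCLike.I)
    rw [RCLike.re_add_im, norm_mul, RCLike.norm_ofReal, RCLike.norm_ofReal] at h
    have hI : ‖(RCLike.I : 𝕜)‖ ≤ 1 := by
      rw [RCLike.norm_I]
      split_ifs <;> norm_num
    exact h.trans (add_le_add_right (mul_le_of_le_one_right (abs_nonneg _) hI) _)

/-- The quantitative form of Rosenthal's theorem. -/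
theorem exists_subseq_ellOne_lower_bound {x : ℕ → X} {B ε δ : ℝ} (hB : ∀ n, ‖x n‖ ≤ B)
    (hε : 0 < ε) (hδ : 0 < δ)
    (h : ∀ φ : ℕ → ℕ, StrictMono φ → ¬ IsEpsWeakCauchySeq 𝕜 ε (x ∘ φ)) :
    ∃ φ : ℕ → ℕ, StrictMono φ ∧ ∀ a : ℕ →₀ 𝕜,
      (ellOneConst 𝕜 * ε - δ) * (a.sum fun _ r => |RCLike.re r| + |RCLike.im r|) ≤
        ‖a.sum fun n r => r • x (φ n)‖ := by
  -- With η = δ/2 the distance defect and the approximation error each cost at most δ times the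
  -- total; halving leaves κε - δ.
  obtain ⟨φ, hφ, c, d, hcd, hind⟩ :=
    exists_independent_subseq_of_not_isEpsWeakCauchySeq hB (half_pos hδ) h
  refine ⟨φ, hφ, fun a => ?_⟩
  have h1 := sum_abs_le_of_independent hcd hind RCLike.reLm (fun z => RCLike.abs_re_le_norm z) a
  have h2 := sum_abs_le_of_independent hcd hind RCLike.imLm (fun z => RCLike.abs_im_le_norm z) a
  simp only [RCLike.reLm_coe, RCLike.imLm_coe] at h1 h2
  have h3 := ellOneConst_mul_le_max a
  have h4 := sum_norm_le_sum_abs_re_add_abs_im a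
  have hre : (a.sum fun _ r => |RCLike.re r|) ≤ a.sum fun _ r => |RCLike.re r| + |RCLike.im r| :=
    Finset.sum_le_sum fun _ _ => le_add_of_nonneg_right (abs_nonneg _)
  have him : (a.sum fun _ r => |RCLike.im r|) ≤ a.sum fun _ r => |RCLike.re r| + |RCLike.im r| :=
    Finset.sum_le_sum fun _ _ => le_add_of_nonneg_left (abs_nonneg _)
  have h5 := mul_le_mul_of_nonneg_left h4 hδ.le
  rcases le_max_iff.1 h3 with h3 | h3
  · have h6 := mul_le_mul_of_nonneg_left h3 hε.le
    have h7 := mul_le_mul_of_nonneg_left hre hδ.le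
    nlinarith
  · have h6 := mul_le_mul_of_nonneg_left h3 hε.le
    have h7 := mul_le_mul_of_nonneg_left him hδ.le
    nlinarith

/-! ### Weak Cauchy diagonal sequences -/

/-- If all subsequences have `ε`-weak Cauchy subsequences for all `ε > 0`, then some subsequence is
weak Cauchy. -/
theorem exists_subseq_isWeakCauchySeq {x : ℕ → X}
    (h : ∀ ε : ℝ, 0 < ε → ∀ φ : ℕ → ℕ, StrictMono φ →
      ∃ ψ : ℕ → ℕ, StrictMono ψ ∧ IsEpsWeakCauchySeq 𝕜 ε (x ∘ φ ∘ ψ)) :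
    ∃ φ : ℕ → ℕ, StrictMono φ ∧ IsWeakCauchySeq 𝕜 (x ∘ φ) := by
  obtain ⟨n, s, hn, -, hR, hmem⟩ := exists_strictMono_diagonal
    (fun φ : {φ : ℕ → ℕ // StrictMono φ} => Set.range φ.1)
    (fun k _ _ φ => IsEpsWeakCauchySeq 𝕜 (1 / ((k : ℝ) + 1)) (x ∘ φ.1)) (by
      rintro k ⟨φ, hφ⟩
      obtain ⟨ψ, hψ, hψc⟩ := h (1 / ((k : ℝ) + 1)) (by positivity) φ hφ
      -- The shift by one puts the new range strictly beyond `φ 0`.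
      refine ⟨φ 0, ⟨0, rfl⟩, ⟨fun i => φ (ψ (i + 1)), fun i j hij => hφ (hψ (by omega))⟩, ?_, ?_⟩
      · intro f hf
        obtain ⟨n₀, hn₀⟩ := hψc f hf
        exact ⟨n₀, fun i hi j hj => hn₀ (i + 1) (by omega) (j + 1) (by omega)⟩
      · rintro _ ⟨i, rfl⟩
        exact ⟨⟨_, rfl⟩, hφ ((Nat.zero_le _).trans_lt (hψ i.succ_pos))⟩) ⟨id, strictMono_id⟩
  refine ⟨n, hn, fun f => Metric.cauchySeq_iff.2 fun ε hε => ?_⟩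
  -- Scaling by ‖f‖ + 1 brings `f` into the unit ball, including when `f = 0`.
  have hC : 0 < ‖f‖ + 1 := by positivity
  obtain ⟨k, hk⟩ := exists_nat_one_div_lt (div_pos hε hC)
  have hg : ‖((‖f‖ + 1 : ℝ) : 𝕜)⁻¹ • f‖ ≤ 1 := by
    rw [norm_smul, norm_inv, RCLike.norm_ofReal, abs_of_pos hC, inv_mul_le_iff₀ hC]
    linarith
  obtain ⟨n₀, hn₀⟩ := hR k _ hg
  have hlarge : ∀ l ≥ max (k + 1) ((s (k + 1)).1 n₀), ∃ i ≥ n₀, (s (k + 1)).1 i = n l := by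
    intro l hl
    obtain ⟨i, hi⟩ := hmem (k + 1) l ((le_max_left _ _).trans hl)
    refine ⟨i, (s (k + 1)).2.le_iff_le.1 ?_, hi⟩
    rw [hi]
    exact ((le_max_right _ _).trans hl).trans (hn.id_le l)
  refine ⟨max (k + 1) ((s (k + 1)).1 n₀), fun l hl m hm => ?_⟩
  obtain ⟨i, hi, hil⟩ := hlarge l hl
  obtain ⟨j, hj, hjm⟩ := hlarge m hm
  have := hn₀ i hi j hj
  simp only [Function.comp_apply, hil, hjm, smul_apply, ← smul_sub] at this
  rw [norm_smul, norm_inv, RCLike.norm_ofReal, abs_of_pos hC, inv_mul_lt_iff₀ hC] at this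
  rw [dist_eq_norm]
  refine this.trans ?_
  rwa [lt_div_iff₀ hC, mul_comm] at hk

/-! ### Equivalence with the ℓ₁ basis -/

theorem norm_sum_smul_ellOneBasis (a : ℕ →₀ 𝕜) :
    ‖a.sum fun n r => r • ellOneBasis 𝕜 n‖ = a.sum fun _ r => ‖r‖ := by
  have h := lp.norm_sum_single (p := 1) (E := fun _ : ℕ => 𝕜) (by simp) (fun n => a n) a.support
  simp only [ENNReal.toReal_one, Real.rpow_one] at h
  rw [Finsupp.sum, Finsupp.sum, ← h]
  congr 1
  refine Finset.sum_congr rfl fun n _ => ?_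
  rw [ellOneBasis, ← lp.single_smul, smul_eq_mul, mul_one]

theorem seqEquivalent_ellOneBasis_of_lower_bound {y : ℕ → X} {B c : ℝ} (hc : 0 < c)
    (hB : ∀ n, ‖y n‖ ≤ B)
    (h : ∀ a : ℕ →₀ 𝕜, c * (a.sum fun _ r => |RCLike.re r| + |RCLike.im r|) ≤
      ‖a.sum fun n r => r • y n‖) : SeqEquivalent 𝕜 y (ellOneBasis 𝕜) := by
  have hB0 : 0 ≤ B := (norm_nonneg _).trans (hB 0)
  -- `B` may be zero, whereas the upper constant must be positive.
  refine ⟨c, B + 1, hc, by linarith, fun a => ?_⟩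
  rw [norm_sum_smul_ellOneBasis]
  refine ⟨(mul_le_mul_of_nonneg_left (sum_norm_le_sum_abs_re_add_abs_im a) hc.le).trans (h a), ?_⟩
  rw [Finsupp.sum, Finsupp.sum, Finset.mul_sum]
  refine norm_sum_le_of_le _ fun k _ => ?_
  rw [norm_smul, mul_comm]
  exact mul_le_mul_of_nonneg_right ((hB k).trans (by linarith)) (norm_nonneg _)

end Banach

theorem mainTheorem2 {𝕜 : Type*} [RCLike 𝕜] {X : Type*} [NormedAddCommGroup X] [NormedSpace 𝕜 X]
    [CompleteSpace X] (x : ℕ → X) (hx : Bornology.IsBounded (Set.range x)) :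
    (∃ φ : ℕ → ℕ, StrictMono φ ∧
      (IsWeakCauchySeq 𝕜 (x ∘ φ) ∨ SeqEquivalent 𝕜 (x ∘ φ) (ellOneBasis 𝕜))) ∧
    (∀ ε : ℝ, 0 < ε →
      (∃ φ : ℕ → ℕ, StrictMono φ ∧ IsEpsWeakCauchySeq 𝕜 ε (x ∘ φ)) ∨
      ∀ δ : ℝ, 0 < δ → ∃ φ : ℕ → ℕ, StrictMono φ ∧ ∀ a : ℕ →₀ 𝕜,
        (ellOneConst 𝕜 * ε - δ) * (a.sum fun _ r => |RCLike.re r| + |RCLike.im r|) ≤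
          ‖a.sum fun n r => r • x (φ n)‖) := by
  obtain ⟨B, hB⟩ := hx.exists_norm_le
  replace hB : ∀ n, ‖x n‖ ≤ B := fun n => hB _ ⟨n, rfl⟩
  refine ⟨?_, fun ε hε => or_iff_not_imp_left.2 fun h δ hδ =>
    exists_subseq_ellOne_lower_bound hB hε hδ fun φ hφ hc => h ⟨φ, hφ, hc⟩⟩
  by_cases h : ∀ ε : ℝ, 0 < ε → ∀ φ : ℕ → ℕ, StrictMono φ →
      ∃ ψ : ℕ → ℕ, StrictMono ψ ∧ IsEpsWeakCauchySeq 𝕜 ε (x ∘ φ ∘ ψ)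
  · obtain ⟨φ, hφ, hc⟩ := exists_subseq_isWeakCauchySeq h
    exact ⟨φ, hφ, Or.inl hc⟩
  push Not at h
  obtain ⟨ε, hε, φ, hφ, h⟩ := h
  -- Taking δ = κε/2 leaves the positive lower constant κε - δ = κε/2.
  have hpos : 0 < ellOneConst 𝕜 * ε / 2 := half_pos (mul_pos ellOneConst_pos hε)
  obtain ⟨ψ, hψ, hlow⟩ := exists_subseq_ellOne_lower_bound (x := x ∘ φ) (fun n => hB _) hε hpos h
  refine ⟨φ ∘ ψ, hφ.comp hψ, Or.inr ?_⟩
  refine seqEquivalent_ellOneBasis_of_lower_bound hpos (fun n => hB _) fun a => ?_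
  simpa only [sub_half, Function.comp_apply] using hlow a
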